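/- All graphs are finite and simple. Let $d=(d_1,\dots,d_n)$, $d_1\ge\dots\ge d_n$, be the degree sequence of a graph. A \emph{realization} of $d$ is a graph with vertex set $[n]=\{1,\dots,n\}$ in which vertex $i$ has degree $d_i$ for every $i\in[n]$. A \emph{2-switch} on a graph $G$ with four distinct vertices $a,b,c,e$ such that $ab,ce$ are edges and $ae,bc$ are non-edges is the operation of deleting the edges $ab,ce$ and adding the edges $ae,bc$. The \emph{realization graph} $\mathscr{G}(d)$ is the graph whose vertices are the realizations of $d$, two of them being adjacent if and only if some 2-switch changes one into the other. A graph is a \emph{hypercube} if, for some integer $k\ge 0$, it is isomorphic to the graph on $\{0,1\}^k$ in which two vectors are adjacent if and only if they differ in exactly one entry. A graph is \emph{split} if its vertex set can be partitioned into a clique and an independent set (either possibly empty), and it is \emph{$P_4$-reducible} if each of its vertices belongs to at most one induced path on four vertices. **Theorem.** The realization graph $\mathscr{G}(d)$ is a hypercube if and only if $d$ is the degree sequence of a split $P_4$-reducible graph. -/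

import Mathlib

namespace RealizationGraph

/-- The graph obtained from `G` by deleting the edges `ab`, `cd` and adding the edges `ad`, `bc`. -/
def twoSwitch {V : Type*} (G : SimpleGraph V) (a b c d : V) : SimpleGraph V :=
  G.deleteEdges {s(a, b), s(c, d)} ⊔ SimpleGraph.fromEdgeSet {s(a, d), s(b, c)}

/-- `H` is obtained from `G` by performing some 2-switch: there are four distinct vertices
`a, b, c, d` such that `ab`, `cd` are edges of `G` and `ad`, `bc` are not, and `H` results from
deleting `ab`, `cd` and adding `ad`, `bc`. -/
def IsTwoSwitch {V : Type*} (G H : SimpleGraph V) : Prop :=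
  ∃ a b c d : V, a ≠ b ∧ a ≠ c ∧ a ≠ d ∧ b ≠ c ∧ b ≠ d ∧ c ≠ d ∧
    G.Adj a b ∧ G.Adj c d ∧ ¬ G.Adj a d ∧ ¬ G.Adj b c ∧ H = twoSwitch G a b c d

/-- Undoing a 2-switch is a 2-switch. -/
theorem IsTwoSwitch.symm {V : Type*} {G H : SimpleGraph V} (h : IsTwoSwitch G H) :
    IsTwoSwitch H G := by
  obtain ⟨a, b, c, d, hab, hac, had, hbc, hbd, hcd, h1, h2, h3, h4, rfl⟩ := h
  refine ⟨a, d, c, b, had, hac, hab, hcd.symm, hbd.symm, hbc.symm, ?_, ?_, ?_, ?_, ?_⟩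
  · simp [twoSwitch, had]
  · simp [twoSwitch, hbc.symm]
  · simp [twoSwitch, hab, hac, had, hbc, hbd]
  · simp [twoSwitch, hcd.symm, hac.symm, had.symm, hbc.symm, hbd.symm]
  · ext x y
    have h1' := h1.symm
    have h2' := h2.symm
    have h3' : ¬ G.Adj d a := fun h => h3 h.symm
    have h4' : ¬ G.Adj c b := fun h => h4 h.symm
    have hne : G.Adj x y → x ≠ y := fun h => h.ne
    simp only [twoSwitch, SimpleGraph.sup_adj, SimpleGraph.deleteEdges_adj,
      SimpleGraph.fromEdgeSet_adj, Set.mem_insert_iff, Set.mem_singleton_iff, Sym2.eq_iff]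
    grind

/-- A 2-switch always changes the graph. -/
theorem IsTwoSwitch.ne {V : Type*} {G H : SimpleGraph V} (h : IsTwoSwitch G H) : G ≠ H := by
  obtain ⟨a, b, c, d, hab, hac, had, hbc, hbd, hcd, h1, h2, h3, h4, rfl⟩ := h
  intro h
  apply h3
  rw [h]
  simp [twoSwitch, had]

open scoped Classical in
/-- `G` is a labeled realization of `d = (d₁, …, dₙ)`: a graph on the fixed `n`-element vertex set
in which vertex `i` has degree `dᵢ`. -/
def IsRealization {n : ℕ} (d : Fin n → ℕ) (G : SimpleGraph (Fin n)) : Prop :=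
  ∀ i, G.degree i = d i

open scoped Classical in
/-- `d = (d₁, …, dₙ)` is the degree sequence of the finite graph `G`: it lists the degrees of the
vertices of `G`, in descending order. -/
def IsDegreeSequenceOf {n : ℕ} (d : Fin n → ℕ) {V : Type*} [Fintype V] (G : SimpleGraph V) :
    Prop :=
  Antitone d ∧ ∃ e : Fin n ≃ V, ∀ i, G.degree (e i) = d i

/-- The (2-switch) realization graph of `d`: its vertices are the labeled realizations of `d`, and
two realizations are adjacent when some 2-switch changes one into the other. -/
def realizationGraph {n : ℕ} (d : Fin n → ℕ) :
    SimpleGraph {G : SimpleGraph (Fin n) // IsRealization d G} where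
  Adj G H := IsTwoSwitch G.1 H.1
  symm := ⟨fun _ _ h => h.symm⟩
  loopless := ⟨fun _ h => h.ne rfl⟩

/-- The hypercube of dimension `k`: (0,1)-vectors of length `k`, adjacent when they differ in
exactly one entry. -/
def hypercube (k : ℕ) : SimpleGraph (Fin k → Bool) where
  Adj x y := hammingDist x y = 1
  symm := ⟨fun x y h => by rwa [hammingDist_comm]⟩
  loopless := ⟨fun x h => by simp at h⟩

/-- A graph is a hypercube if it is isomorphic to the hypercube of some dimension `k ≥ 0`. -/
def IsHypercube {V : Type*} (G : SimpleGraph V) : Prop :=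
  ∃ k : ℕ, Nonempty (G ≃g hypercube k)

/-- A graph is split if its vertex set can be partitioned into a clique and an independent set
(either of which may be empty). -/
def IsSplit {V : Type*} (G : SimpleGraph V) : Prop :=
  ∃ K : Set V, G.IsClique K ∧ G.IsIndepSet Kᶜ

/-- The vertex set `S` induces a path on four vertices in `G`. -/
def InducesP4 {V : Type*} (G : SimpleGraph V) (S : Set V) : Prop :=
  Nonempty (G.induce S ≃g SimpleGraph.pathGraph 4)

/-- A graph is `P₄`-reducible if each of its vertices belongs to at most one induced path on four
vertices. -/
def IsP4Reducible {V : Type*} (G : SimpleGraph V) : Prop :=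
  ∀ (v : V) (S T : Set V), v ∈ S → v ∈ T → InducesP4 G S → InducesP4 G T → S = T

end RealizationGraph

/-! A 2-switch acts on an alternating closed walk `a b c e`, and everything rests on when it amounts
to exchanging the labels `a` and `c`.

Hypercube implies structure: a hypercube has no triangle, and two distinct vertices never have three
common neighbors. If an alternating walk had both or neither of its diagonals, or if an outside
vertex distinguished two opposite vertices, a third realization would complete a triangle
(`IsHypercube.diagonal`, `IsHypercube.adj_iff_of_alternating`). So every 2-switch is a transposition
of labels. Three pairwise incomparable vertices would then give three transpositions leading to a
common 3-cycle, hence three common neighbors (`IsHypercube.not_incomparable`). These facts exclude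
induced `2K₂`, `C₄` and `C₅`, so every realization is split, and they force intersecting induced
`P₄`s to coincide.

Structure implies hypercube: in a split `P₄`-reducible graph the induced `P₄`s are vertex-disjoint
and each 2-switch exchanges the midpoints of one of them. These exchanges are independent and keep
the midpoint pairs, so subsets of the paths correspond to the realizations reachable by 2-switches
(`PathList.isTwoSwitch_flip_iff`). All realizations are reachable, since realization graphs are
connected (`reflTransGen_isTwoSwitch`). -/

namespace RealizationGraph

/-! ### 2-switches as alternating closed walks; connectivity of the realization graph. -/

section Switch

variable {V : Type*}

theorem isRealization_iff {n : ℕ} (d : Fin n → ℕ) (G : SimpleGraph (Fin n)) :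
    IsRealization d G ↔ ∀ i, (G.neighborSet i).ncard = d i := by
  classical
  simp only [IsRealization, ← Nat.card_coe_set_eq, Nat.card_eq_fintype_card,
    SimpleGraph.card_neighborSet_eq_degree]

theorem twoSwitch_adj {G : SimpleGraph V} {a b c d u v : V} :
    (twoSwitch G a b c d).Adj u v ↔
      (G.Adj u v ∧ ¬ ((u = a ∧ v = b ∨ u = b ∧ v = a) ∨ (u = c ∧ v = d ∨ u = d ∧ v = c))) ∨
      ((u = a ∧ v = d ∨ u = d ∧ v = a) ∨ (u = b ∧ v = c ∨ u = c ∧ v = b)) ∧ u ≠ v := by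
  simp only [twoSwitch, SimpleGraph.sup_adj, SimpleGraph.deleteEdges_adj,
      SimpleGraph.fromEdgeSet_adj, Set.mem_insert_iff, Set.mem_singleton_iff, Sym2.eq_iff]

/-- The closed walk `a b c d` alternates between edges and non-edges of `G`. -/
structure IsAlternating (G : SimpleGraph V) (a b c d : V) : Prop where
  ab : G.Adj a b
  cd : G.Adj c d
  ad : ¬ G.Adj a d
  bc : ¬ G.Adj b c
  ac_ne : a ≠ c
  bd_ne : b ≠ d
  ad_ne : a ≠ d
  bc_ne : b ≠ c

theorem IsAlternating.isTwoSwitch {G : SimpleGraph V} {a b c d : V}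
    (h : IsAlternating G a b c d) : IsTwoSwitch G (twoSwitch G a b c d) :=
  ⟨a, b, c, d, h.ab.ne, h.ac_ne, h.ad_ne, h.bc_ne, h.bd_ne, h.cd.ne, h.ab, h.cd, h.ad, h.bc, rfl⟩

theorem isTwoSwitch_iff {G H : SimpleGraph V} :
    IsTwoSwitch G H ↔ ∃ a b c d, IsAlternating G a b c d ∧ H = twoSwitch G a b c d := by
  constructor
  · rintro ⟨a, b, c, d, hab, hac, had, hbc, hbd, hcd, h1, h2, h3, h4, rfl⟩
    exact ⟨a, b, c, d, ⟨h1, h2, h3, h4, hac, hbd, had, hbc⟩, rfl⟩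
  · rintro ⟨a, b, c, d, h, rfl⟩
    exact h.isTwoSwitch

theorem IsAlternating.opposite {G : SimpleGraph V} {a b c d : V} (h : IsAlternating G a b c d) :
    IsAlternating G c d a b :=
  ⟨h.cd, h.ab, fun e => h.bc e.symm, fun e => h.ad e.symm, h.ac_ne.symm, h.bd_ne.symm,
    h.bc_ne.symm, h.ad_ne.symm⟩

theorem IsAlternating.reverse {G : SimpleGraph V} {a b c d : V} (h : IsAlternating G a b c d) :
    IsAlternating G b a d c :=
  ⟨h.ab.symm, h.cd.symm, h.bc, h.ad, h.bd_ne, h.ac_ne, h.bc_ne, h.ad_ne⟩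

theorem twoSwitch_opposite (G : SimpleGraph V) (a b c d : V) :
    twoSwitch G c d a b = twoSwitch G a b c d := by
  ext u v; simp only [twoSwitch_adj]; grind

theorem twoSwitch_reverse (G : SimpleGraph V) (a b c d : V) :
    twoSwitch G b a d c = twoSwitch G a b c d := by
  ext u v; simp only [twoSwitch_adj]; grind

theorem IsAlternating.ncard_neighborSet_left [Finite V] {G : SimpleGraph V} {a b c d : V}
    (h : IsAlternating G a b c d) :
    ((twoSwitch G a b c d).neighborSet a).ncard = (G.neighborSet a).ncard := by
  have e : (twoSwitch G a b c d).neighborSet a = insert d (G.neighborSet a \ {b}) := by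
    ext u
    have := h.ab.ne
    obtain ⟨h1, h2, h3, h4, h5, h6, h7, h8⟩ := h
    simp only [SimpleGraph.mem_neighborSet, twoSwitch_adj, Set.mem_insert_iff, Set.mem_sdiff,
      Set.mem_singleton_iff]
    grind
  rw [e, Set.ncard_insert_of_notMem (by simp [h.ad]),
    Set.ncard_sdiff_singleton_add_one (by simpa using h.ab)]

theorem IsTwoSwitch.ncard_neighborSet [Finite V] {G H : SimpleGraph V} (h : IsTwoSwitch G H)
    (v : V) : (H.neighborSet v).ncard = (G.neighborSet v).ncard := by
  obtain ⟨a, b, c, d, hal, rfl⟩ := isTwoSwitch_iff.1 h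
  by_cases ha : v = a
  · rw [ha]
    exact hal.ncard_neighborSet_left
  by_cases hb : v = b
  · rw [hb, ← twoSwitch_reverse]
    exact hal.reverse.ncard_neighborSet_left
  by_cases hc : v = c
  · rw [hc, ← twoSwitch_opposite]
    exact hal.opposite.ncard_neighborSet_left
  by_cases hd : v = d
  · rw [hd, ← twoSwitch_opposite, ← twoSwitch_reverse]
    exact hal.opposite.reverse.ncard_neighborSet_left
  congr 1
  ext u
  simp [twoSwitch_adj, ha, hb, hc, hd]

theorem IsTwoSwitch.isRealization {n : ℕ} {d : Fin n → ℕ} {G H : SimpleGraph (Fin n)}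
    (h : IsTwoSwitch G H) (hG : IsRealization d G) : IsRealization d H := by
  rw [isRealization_iff] at hG ⊢
  exact fun i => (h.ncard_neighborSet i).trans (hG i)

/-- If every other vertex sees both or neither of `a`, `c`, the 2-switch exchanges `a` and `c`. -/
theorem IsAlternating.twoSwitch_eq_comap_swap [DecidableEq V] {G : SimpleGraph V} {a b c d : V}
    (h : IsAlternating G a b c d)
    (hu : ∀ v, v ≠ a → v ≠ b → v ≠ c → v ≠ d → (G.Adj v a ↔ G.Adj v c)) :
    twoSwitch G a b c d = G.comap (Equiv.swap a c) := by
  ext u v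
  have h9 := h.ab.ne
  have h10 := h.cd.ne
  obtain ⟨h1, h2, h3, h4, h5, h6, h7, h8⟩ := h
  have huu := hu u
  have huv := hu v
  clear hu
  have s1 := G.adj_comm u v
  have s2 := G.adj_comm v a
  have s3 := G.adj_comm v c
  have s4 := G.adj_comm a b
  have s5 := G.adj_comm c d
  have s6 := G.adj_comm a d
  have s7 := G.adj_comm b c
  have s8 := G.adj_comm a c
  have s9 := G.loopless.irrefl u
  have s10 := G.loopless.irrefl a
  have s11 := G.loopless.irrefl c
  simp only [twoSwitch_adj, SimpleGraph.comap_adj, Equiv.swap_apply_def]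
  grind

/-! ### Connectivity of the realization graph -/

/-- Pigeonhole: `v` sees `x` but not `y`, while outside `S` the vertex `y` has at least as many
neighbors as `x`, so some neighbor `z` of `y` is missed by `x`. -/
theorem exists_alternating_of_ncard_le [Finite V] {G : SimpleGraph V} {S : Set V} {v x y : V}
    (hv : v ∉ S) (hy : y ∉ S) (hvx : G.Adj v x) (hvy : ¬ G.Adj v y) (hyv : y ≠ v)
    (hxy : (G.neighborSet x \ S).ncard ≤ (G.neighborSet y \ S).ncard) :
    ∃ z, z ∉ S ∧ IsAlternating G v x z y := by
  classical
  by_contra! hcon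
  have hne : x ≠ y := by rintro rfl; exact hvy hvx
  -- The swap takes care of the case where `x` and `y` are adjacent: `x`, as a neighbor of `y`, is
  -- sent to `y`, a neighbor of `x`.
  have key : Equiv.swap x y '' (G.neighborSet y \ S) ⊆ (G.neighborSet x \ S) \ {v} := by
    rintro _ ⟨u, ⟨hu, huS⟩, rfl⟩
    rw [SimpleGraph.mem_neighborSet] at hu
    rcases eq_or_ne u x with rfl | hux
    · simp [hy, hu.symm, hyv]
    · rw [Equiv.swap_apply_of_ne_of_ne hux hu.ne']
      have huv : u ≠ v := by rintro rfl; exact hvy hu.symm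
      refine ⟨⟨?_, huS⟩, huv⟩
      by_contra hxu
      exact hcon u huS ⟨hvx, hu.symm, hvy, hxu, huv.symm, hne, hyv.symm, hux.symm⟩
  have h1 := Set.ncard_le_ncard key
  rw [Set.ncard_image_of_injective _ (Equiv.injective _)] at h1
  have h2 := Set.ncard_sdiff_singleton_lt_of_mem
    (show v ∈ G.neighborSet x \ S from ⟨hvx.symm, hv⟩)
  omega

theorem ReflTransGen.ncard_neighborSet [Finite V] {G H : SimpleGraph V}
    (h : Relation.ReflTransGen IsTwoSwitch G H) (v : V) :
    (H.neighborSet v).ncard = (G.neighborSet v).ncard := by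
  induction h with
  | refl => rfl
  | tail _ h ih => exact (h.ncard_neighborSet v).trans ih

/-- Graphs with equal degrees that agree at `S` can be made to agree at `v` as well. -/
theorem exists_reflTransGen_agree [Finite V] {S : Set V} {v : V} (hv : v ∉ S) :
    ∀ (m : ℕ) (G H : SimpleGraph V),
      (∀ u, (G.neighborSet u).ncard = (H.neighborSet u).ncard) →
      (∀ s ∈ S, ∀ u, G.Adj s u ↔ H.Adj s u) →
      (G.neighborSet v \ H.neighborSet v).ncard ≤ m →
      ∃ G' H', Relation.ReflTransGen IsTwoSwitch G G' ∧ Relation.ReflTransGen IsTwoSwitch H H' ∧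
        ∀ s ∈ insert v S, ∀ u, G'.Adj s u ↔ H'.Adj s u := by
  intro m
  induction m with
  | zero =>
    intro G H hdeg hS hm
    refine ⟨G, H, .refl, .refl, ?_⟩
    have h0 : G.neighborSet v ⊆ H.neighborSet v := by
      rw [← Set.sdiff_eq_empty, ← Set.ncard_eq_zero]; omega
    have h1 := Set.eq_of_subset_of_ncard_le h0 (hdeg v).ge
    rintro s (rfl | hs) u
    · exact Set.ext_iff.1 h1 u
    · exact hS s hs u
  | succ m ih =>
    intro G H hdeg hS hm
    by_cases h0 : (G.neighborSet v \ H.neighborSet v).ncard ≤ m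
    · exact ih G H hdeg hS h0
    have h1 : (H.neighborSet v \ G.neighborSet v).ncard =
        (G.neighborSet v \ H.neighborSet v).ncard :=
      (Set.ncard_eq_ncard_iff_ncard_sdiff_eq_ncard_sdiff (Set.toFinite _) (Set.toFinite _)).1
        (hdeg v).symm
    obtain ⟨x, hx, hx'⟩ := Set.nonempty_of_ncard_ne_zero
      (s := G.neighborSet v \ H.neighborSet v) (by omega)
    obtain ⟨y, hy, hy'⟩ := Set.nonempty_of_ncard_ne_zero
      (s := H.neighborSet v \ G.neighborSet v) (by omega)
    rw [SimpleGraph.mem_neighborSet] at hx hx' hy hy'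
    have hxS : x ∉ S := fun h => hx' ((hS x h v).1 hx.symm).symm
    have hyS : y ∉ S := fun h => hy' ((hS y h v).2 hy.symm).symm
    -- Both graphs have the same edges into `S`, so degrees outside `S` agree too. Hence comparing
    -- `x` with `y` gives the same answer in `G` and `H`, and decides which of the two graphs to
    -- switch.
    have hdS : ∀ u, (G.neighborSet u \ S).ncard = (H.neighborSet u \ S).ncard := by
      intro u
      have e : G.neighborSet u ∩ S = H.neighborSet u ∩ S := by
        ext s
        simp only [Set.mem_inter_iff, SimpleGraph.mem_neighborSet]
        have := hS s
        have := G.adj_comm u s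
        have := H.adj_comm u s
        grind
      have a1 := Set.ncard_inter_add_ncard_sdiff_eq_ncard (G.neighborSet u) S
      have a2 := Set.ncard_inter_add_ncard_sdiff_eq_ncard (H.neighborSet u) S
      have := hdeg u
      rw [e] at a1
      omega
    have hlt : ∀ A : Set V, A ⊆ G.neighborSet v \ H.neighborSet v → x ∉ A → A.ncard ≤ m := by
      intro A hA hxA
      have := Set.ncard_lt_ncard (Set.ssubset_iff_subset_ne.2
        ⟨hA, fun e => hxA (e ▸ ⟨hx, hx'⟩)⟩)
      omega
    rcases le_total (G.neighborSet x \ S).ncard (G.neighborSet y \ S).ncard with hle | hle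
    · obtain ⟨z, hz, ha⟩ := exists_alternating_of_ncard_le hv hyS hx hy' hy.ne' hle
      obtain ⟨G', H', hG', hH', hh⟩ := ih (twoSwitch G v x z y) H
        (fun u => (ha.isTwoSwitch.ncard_neighborSet u).trans (hdeg u))
        (by
          intro s hs u
          rw [← hS s hs u, twoSwitch_adj]
          grind)
        (by
          obtain ⟨g1, g2, g3, g4, g5, g6, g7, g8⟩ := ha
          have := hx.ne
          apply hlt
          · intro u
            simp only [Set.mem_sdiff, SimpleGraph.mem_neighborSet, twoSwitch_adj]
            grind
          · simp only [Set.mem_sdiff, SimpleGraph.mem_neighborSet, twoSwitch_adj]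
            grind)
      exact ⟨G', H', .head ha.isTwoSwitch hG', hH', hh⟩
    · rw [hdS, hdS] at hle
      obtain ⟨z, hz, ha⟩ := exists_alternating_of_ncard_le hv hxS hy hx' hx.ne' hle
      obtain ⟨G', H', hG', hH', hh⟩ := ih G (twoSwitch H v y z x)
        (fun u => (hdeg u).trans (ha.isTwoSwitch.ncard_neighborSet u).symm)
        (by
          intro s hs u
          rw [hS s hs u, twoSwitch_adj]
          grind)
        (by
          obtain ⟨g1, g2, g3, g4, g5, g6, g7, g8⟩ := ha
          have := hx.ne
          apply hlt
          · intro u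
            simp only [Set.mem_sdiff, SimpleGraph.mem_neighborSet, twoSwitch_adj]
            grind
          · simp only [Set.mem_sdiff, SimpleGraph.mem_neighborSet, twoSwitch_adj]
            grind)
      exact ⟨G', H', hG', .head ha.isTwoSwitch hH', hh⟩

/-- Any two graphs with the same degrees are linked by 2-switches. -/
theorem reflTransGen_isTwoSwitch [Finite V] (G H : SimpleGraph V)
    (h : ∀ v, (G.neighborSet v).ncard = (H.neighborSet v).ncard) :
    Relation.ReflTransGen IsTwoSwitch G H := by
  classical
  have : Fintype V := Fintype.ofFinite V
  -- `T` contains the vertices whose neighborhoods may still differ; both graphs vary in the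
  -- induction because either may be switched.
  suffices key : ∀ (T : Finset V) (G H : SimpleGraph V),
      (∀ v, (G.neighborSet v).ncard = (H.neighborSet v).ncard) →
      (∀ s ∉ T, ∀ u, G.Adj s u ↔ H.Adj s u) → Relation.ReflTransGen IsTwoSwitch G H from
    key Finset.univ G H h (by simp)
  intro T
  induction T using Finset.induction_on with
  | empty =>
    intro G H _ hS
    rw [show G = H by ext s u; exact hS s (by simp) u]
  | insert v T hvT ih =>
    intro G H hdeg hS
    obtain ⟨G', H', hG, hH, hh⟩ := exists_reflTransGen_agree
      (S := {s | s ∉ insert v T}) (v := v) (by simp) _ G H hdeg hS le_rfl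
    have hGH := ih G' H' (fun u => by
      rw [ReflTransGen.ncard_neighborSet hG, ReflTransGen.ncard_neighborSet hH, hdeg])
      (fun s hs u => hh s (by simp only [Set.mem_insert_iff, Set.mem_ofPred_eq]; grind) u)
    have : Std.Symm (IsTwoSwitch (V := V)) := ⟨fun _ _ h => h.symm⟩
    exact (hG.trans hGH).trans (symm hH)

end Switch

/-! ### Local structure of hypercubes. -/

theorem hypercube_adj_iff {k : ℕ} {x y : Fin k → Bool} :
    (hypercube k).Adj x y ↔ ∃ i, ∀ j, x j ≠ y j ↔ j = i := by
  simp only [hypercube, hammingDist, Finset.card_eq_one, Finset.ext_iff, Finset.mem_filter,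
    Finset.mem_univ, true_and, Finset.mem_singleton]

theorem hypercube_adj_iff_update {k : ℕ} {x y : Fin k → Bool} :
    (hypercube k).Adj x y ↔ ∃ i, y = Function.update x i (!x i) := by
  rw [hypercube_adj_iff]
  refine exists_congr fun i => ⟨fun h => ?_, fun h j => ?_⟩
  · funext j
    have := h j
    by_cases hj : j = i
    · subst hj
      simpa using (Bool.eq_not_of_ne (this.2 rfl).symm)
    · rw [Function.update_of_ne hj]
      exact (not_not.1 fun h => hj (this.1 h)).symm
  · rw [h]
    by_cases hj : j = i
    · subst hj; simp
    · simp [hj]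

/-- Parity: two neighbors of `x` differ in zero or two coordinates. -/
theorem hypercube_triangle_free {k : ℕ} {x y z : Fin k → Bool} (hxy : (hypercube k).Adj x y)
    (hxz : (hypercube k).Adj x z) : ¬ (hypercube k).Adj y z := by
  rw [hypercube_adj_iff_update] at *
  rintro ⟨l, hl⟩
  obtain ⟨i, rfl⟩ := hxy
  obtain ⟨j, rfl⟩ := hxz
  have := congrFun hl i
  have := congrFun hl j
  have := congrFun hl l
  simp only [Function.update_apply] at *
  grind

/-- The vectors `x` and `z` differ in exactly two coordinates, and a common neighbor is `x` flipped
at one of these. -/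
theorem hypercube_common_neighbors {k : ℕ} {x z y₁ y₂ y₃ : Fin k → Bool} (hxz : x ≠ z)
    (h₁ : (hypercube k).Adj x y₁) (h₁' : (hypercube k).Adj y₁ z)
    (h₂ : (hypercube k).Adj x y₂) (h₂' : (hypercube k).Adj y₂ z)
    (h₃ : (hypercube k).Adj x y₃) (h₃' : (hypercube k).Adj y₃ z) :
    y₁ = y₂ ∨ y₁ = y₃ ∨ y₂ = y₃ := by
  rw [hypercube_adj_iff_update] at *
  obtain ⟨i₁, rfl⟩ := h₁
  obtain ⟨i₂, rfl⟩ := h₂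
  obtain ⟨i₃, rfl⟩ := h₃
  obtain ⟨j₁, h₁⟩ := h₁'
  obtain ⟨j₂, h₂⟩ := h₂'
  obtain ⟨j₃, h₃⟩ := h₃'
  have h0 : i₁ ≠ j₁ := by
    rintro rfl
    exact hxz (by simpa using h₁.symm)
  suffices i₁ = i₂ ∨ i₁ = i₃ ∨ i₂ = i₃ by
    rcases this with rfl | rfl | rfl <;> simp
  by_contra! hne
  have e₁ := congrFun (h₁.symm.trans h₂) i₁
  have e₂ := congrFun (h₁.symm.trans h₂) i₂
  have e₃ := congrFun (h₁.symm.trans h₃) i₁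
  have e₄ := congrFun (h₁.symm.trans h₃) i₃
  simp only [Function.update_apply] at e₁ e₂ e₃ e₄
  grind

/-! ### Constraints on realizations when the realization graph is a hypercube. -/

section Hypercube

variable {n : ℕ} {d : Fin n → ℕ} {G : SimpleGraph (Fin n)}

theorem IsHypercube.not_triangle (hd : IsHypercube (realizationGraph d))
    (hG : IsRealization d G) {G₁ G₂ : SimpleGraph (Fin n)} (h₁ : IsTwoSwitch G G₁)
    (h₂ : IsTwoSwitch G G₂) : ¬ IsTwoSwitch G₁ G₂ := by
  obtain ⟨k, ⟨φ⟩⟩ := hd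
  intro h
  have e : ∀ {A B : {G : SimpleGraph (Fin n) // IsRealization d G}},
      IsTwoSwitch A.1 B.1 → (hypercube k).Adj (φ A) (φ B) := fun h => φ.map_adj_iff.2 h
  exact hypercube_triangle_free (e (A := ⟨G, hG⟩) (B := ⟨G₁, h₁.isRealization hG⟩) h₁)
    (e (A := ⟨G, hG⟩) (B := ⟨G₂, h₂.isRealization hG⟩) h₂) (e h)

theorem IsHypercube.common_neighbors (hd : IsHypercube (realizationGraph d))
    (hG : IsRealization d G) {G' H₁ H₂ H₃ : SimpleGraph (Fin n)} (hne : G ≠ G')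
    (h₁ : IsTwoSwitch G H₁) (h₁' : IsTwoSwitch H₁ G')
    (h₂ : IsTwoSwitch G H₂) (h₂' : IsTwoSwitch H₂ G')
    (h₃ : IsTwoSwitch G H₃) (h₃' : IsTwoSwitch H₃ G') : H₁ = H₂ ∨ H₁ = H₃ ∨ H₂ = H₃ := by
  obtain ⟨k, ⟨φ⟩⟩ := hd
  have e : ∀ {A B : {G : SimpleGraph (Fin n) // IsRealization d G}},
      IsTwoSwitch A.1 B.1 → (hypercube k).Adj (φ A) (φ B) := fun h => φ.map_adj_iff.2 h
  let A : {G : SimpleGraph (Fin n) // IsRealization d G} := ⟨G, hG⟩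
  let A' : {G : SimpleGraph (Fin n) // IsRealization d G} :=
    ⟨G', h₁'.isRealization (h₁.isRealization hG)⟩
  let B₁ : {G : SimpleGraph (Fin n) // IsRealization d G} := ⟨H₁, h₁.isRealization hG⟩
  let B₂ : {G : SimpleGraph (Fin n) // IsRealization d G} := ⟨H₂, h₂.isRealization hG⟩
  let B₃ : {G : SimpleGraph (Fin n) // IsRealization d G} := ⟨H₃, h₃.isRealization hG⟩
  have := hypercube_common_neighbors (x := φ A) (z := φ A')
    (fun h => hne (congrArg Subtype.val (φ.injective h)))
    (e (B := B₁) h₁) (e h₁') (e (B := B₂) h₂) (e h₂') (e (B := B₃) h₃) (e h₃')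
  simpa [φ.injective.eq_iff, B₁, B₂, B₃] using this

/-- An alternating closed walk has exactly one diagonal. -/
theorem IsHypercube.diagonal (hd : IsHypercube (realizationGraph d)) (hG : IsRealization d G)
    {a b c e : Fin n} (h : IsAlternating G a b c e) : ¬ (G.Adj a c ↔ G.Adj b e) := by
  intro hiff
  have hab := h.ab.ne
  have hce := h.cd.ne
  obtain ⟨h1, h2, h3, h4, h5, h6, h7, h8⟩ := id h
  -- With both diagonals the four vertices induce `C₄`, the complement of a perfect matching; with
  -- neither, `2K₂`, a perfect matching. Four points have three perfect matchings, and the resulting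
  -- three realizations form a triangle.
  by_cases hac : G.Adj a c
  · have hbe := hiff.1 hac
    have h' : IsAlternating G a c b e :=
      ⟨hac, hbe, h3, fun h => h4 h.symm, hab, hce, h7, h8.symm⟩
    refine hd.not_triangle hG h.isTwoSwitch h'.isTwoSwitch ?_
    refine isTwoSwitch_iff.2 ⟨a, c, e, b, ⟨?_, ?_, ?_, ?_, h7, h8.symm, hab, hce⟩, ?_⟩
    · simp only [twoSwitch_adj]; grind
    · simp only [twoSwitch_adj]; grind [G.adj_comm b e]
    · simp only [twoSwitch_adj]; grind
    · simp only [twoSwitch_adj]; grind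
    · ext u v
      have := G.adj_comm u v
      simp only [twoSwitch_adj]; grind [G.ne_of_adj, G.adj_comm]
  · have hbe : ¬ G.Adj b e := fun h => hac (hiff.2 h)
    have h' : IsAlternating G a b e c :=
      ⟨h1, h2.symm, hac, hbe, h7, h8, h5, h6⟩
    refine hd.not_triangle hG h.isTwoSwitch h'.isTwoSwitch ?_
    refine isTwoSwitch_iff.2 ⟨a, e, b, c, ⟨?_, ?_, ?_, ?_, hab, hce.symm, h5, h6.symm⟩, ?_⟩
    · simp only [twoSwitch_adj]; grind
    · simp only [twoSwitch_adj]; grind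
    · simp only [twoSwitch_adj]; grind
    · simp only [twoSwitch_adj]; grind [G.adj_comm]
    · ext u v
      simp only [twoSwitch_adj]; grind [G.ne_of_adj, G.adj_comm]

/-- Otherwise `b` and `v` see `a` but not `c`, while `e` sees `c` but not `a`. The three ways to
choose which of `b`, `v`, `e` is joined to `c`, the other two being joined to `a`, form a triangle
of realizations. -/
theorem IsHypercube.adj_of_alternating (hd : IsHypercube (realizationGraph d))
    (hG : IsRealization d G) {a b c e v : Fin n} (h : IsAlternating G a b c e)
    (hvb : v ≠ b) (hva : G.Adj v a) (hve : v ≠ e) (hvc' : v ≠ c) : G.Adj v c := by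
  by_contra hvc
  have hab := h.ab.ne
  have hce := h.cd.ne
  have hva' := hva.ne
  obtain ⟨h1, h2, h3, h4, h5, h6, h7, h8⟩ := id h
  have h' : IsAlternating G a v c e := ⟨hva.symm, h2, h3, hvc, h5, hve, h7, hvc'⟩
  refine hd.not_triangle hG h.isTwoSwitch h'.isTwoSwitch ?_
  refine isTwoSwitch_iff.2 ⟨a, v, c, b, ⟨?_, ?_, ?_, ?_, h5, hvb, hab, hvc'⟩, ?_⟩
  · simp only [twoSwitch_adj]; grind [G.adj_comm]
  · simp only [twoSwitch_adj]; grind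
  · simp only [twoSwitch_adj]; grind
  · simp only [twoSwitch_adj]; grind
  · ext u w
    simp only [twoSwitch_adj]; grind [G.ne_of_adj, G.adj_comm]

/-- A vertex outside an alternating closed walk sees both or neither of two opposite vertices. -/
theorem IsHypercube.adj_iff_of_alternating (hd : IsHypercube (realizationGraph d))
    (hG : IsRealization d G) {a b c e v : Fin n} (h : IsAlternating G a b c e)
    (hva : v ≠ a) (hvb : v ≠ b) (hvc : v ≠ c) (hve : v ≠ e) : G.Adj v a ↔ G.Adj v c :=
  ⟨fun h' => hd.adj_of_alternating hG h hvb h' hve hvc,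
    fun h' => hd.adj_of_alternating hG h.opposite hve h' hvb hva⟩

end Hypercube

/-- Each of the vertices `x`, `y` has a neighbor, other than the other one, that is not a neighbor
of the other one. -/
def Incomparable {V : Type*} (G : SimpleGraph V) (x y : V) : Prop :=
  ∃ b e, IsAlternating G x b y e

theorem IsAlternating.incomparable {V : Type*} {G : SimpleGraph V} {a b c d : V}
    (h : IsAlternating G a b c d) : Incomparable G a c := ⟨b, d, h⟩

theorem Incomparable.symm {V : Type*} {G : SimpleGraph V} {x y : V} (h : Incomparable G x y) :
    Incomparable G y x := by
  obtain ⟨b, e, h⟩ := h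
  exact ⟨e, b, h.opposite⟩

theorem Incomparable.comap {V : Type*} {G : SimpleGraph V} {x y : V} (σ : Equiv.Perm V)
    (h : Incomparable G (σ x) (σ y)) : Incomparable (G.comap σ) x y := by
  obtain ⟨b, e, h1, h2, h3, h4, h5, h6, h7, h8⟩ := h
  refine ⟨σ.symm b, σ.symm e, by simpa using h1, by simpa using h2, by simpa using h3,
    by simpa using h4, ?_, ?_, ?_, ?_⟩
  · grind
  · simpa using h6
  · rintro rfl; simp at h7
  · rintro rfl; simp at h8

section Hypercube

variable {n : ℕ} {d : Fin n → ℕ} {G : SimpleGraph (Fin n)}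

theorem IsHypercube.isTwoSwitch_swap (hd : IsHypercube (realizationGraph d))
    (hG : IsRealization d G) {x y : Fin n} (h : Incomparable G x y) :
    IsTwoSwitch G (G.comap (Equiv.swap x y)) := by
  obtain ⟨b, e, h⟩ := h
  rw [← h.twoSwitch_eq_comap_swap fun v h1 h2 h3 h4 => hd.adj_iff_of_alternating hG h h1 h2 h3 h4]
  exact h.isTwoSwitch

/-- The pair `x b` tells the two graphs apart, unless `b = v`, when `x e` does. -/
theorem Incomparable.comap_swap_ne {V : Type*} [DecidableEq V] {G : SimpleGraph V} {x y v : V}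
    (h : Incomparable G x y) (hxv : x ≠ v) :
    G.comap (Equiv.swap x y) ≠ G.comap (Equiv.swap y v) := by
  obtain ⟨b, e, h⟩ := h
  have hab := h.ab.ne
  have hce := h.cd.ne
  obtain ⟨h1, h2, h3, h4, h5, h6, h7, h8⟩ := h
  intro he
  by_cases hbv : b = v
  · have := congrFun (congrFun (congrArg SimpleGraph.Adj he) x) e
    simp only [SimpleGraph.comap_adj, Equiv.swap_apply_def] at this
    grind
  · have := congrFun (congrFun (congrArg SimpleGraph.Adj he) x) b
    simp only [SimpleGraph.comap_adj, Equiv.swap_apply_def] at this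
    grind [G.adj_comm]

/-- Three vertices are never pairwise incomparable. -/
theorem IsHypercube.not_incomparable (hd : IsHypercube (realizationGraph d))
    (hG : IsRealization d G) {x y v : Fin n} (hxy : Incomparable G x y)
    (hyv : Incomparable G y v) : ¬ Incomparable G x v := by
  intro hxv
  have nxy : x ≠ y := hxy.choose_spec.choose_spec.ac_ne
  have nyv : y ≠ v := hyv.choose_spec.choose_spec.ac_ne
  have nxv : x ≠ v := hxv.choose_spec.choose_spec.ac_ne
  have s1 := hd.isTwoSwitch_swap hG hxy
  have s2 := hd.isTwoSwitch_swap hG hyv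
  have s3 := hd.isTwoSwitch_swap hG hxv
  have d12 := hxy.comap_swap_ne nxv
  have d13 := hxy.symm.comap_swap_ne nyv
  have d23 := hyv.comap_swap_ne nxy.symm
  rw [Equiv.swap_comm y x] at d13
  rw [Equiv.swap_comm v x] at d23
  have comp : ∀ σ τ : Equiv.Perm (Fin n), (G.comap σ).comap τ = G.comap (σ * τ) := by
    intro σ τ
    ext u w
    simp
  -- Each of the three transpositions, followed by a suitable second one, gives the same 3-cycle;
  -- this yields three paths of length two with the same ends.
  have e2 : Equiv.swap y v * Equiv.swap x v = Equiv.swap x y * Equiv.swap y v := by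
    ext u : 1
    simp only [Equiv.Perm.mul_apply, Equiv.swap_apply_def]
    grind
  have e3 : Equiv.swap x v * Equiv.swap x y = Equiv.swap x y * Equiv.swap y v := by
    ext u : 1
    simp only [Equiv.Perm.mul_apply, Equiv.swap_apply_def]
    grind
  have t1 := hd.isTwoSwitch_swap (s1.isRealization hG) (x := y) (y := v)
    (.comap _ (by
      rwa [Equiv.swap_apply_right, Equiv.swap_apply_of_ne_of_ne nxv.symm nyv.symm]))
  have t2 := hd.isTwoSwitch_swap (s2.isRealization hG) (x := x) (y := v)
    (.comap _ (by
      rwa [Equiv.swap_apply_right, Equiv.swap_apply_of_ne_of_ne nxy nxv]))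
  have t3 := hd.isTwoSwitch_swap (s3.isRealization hG) (x := x) (y := y)
    (.comap _ (by
      rw [Equiv.swap_apply_left, Equiv.swap_apply_of_ne_of_ne nxy.symm nyv]
      exact hyv.symm))
  rw [comp] at t1 t2 t3
  rw [e2] at t2
  rw [e3] at t3
  have hne : G ≠ G.comap (Equiv.swap x y * Equiv.swap y v) := by
    intro h
    apply d12
    have := congrArg (SimpleGraph.comap (Equiv.swap y v)) h
    rw [comp, mul_assoc, Equiv.swap_mul_self, mul_one] at this
    exact this.symm
  rcases hd.common_neighbors hG hne s1 t1 s2 t2 s3 t3 with h | h | h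
  · exact d12 h
  · exact d13 h
  · exact d23 h

end Hypercube

/-! ### Split graphs by forbidden subgraphs; induced paths. -/

section Split

variable {V : Type*} {G : SimpleGraph V}

/-- Földes–Hammer: a finite graph without induced `2K₂`, `C₄`, `C₅` is split. -/
theorem isSplit_of_forbidden [Finite V]
    (no2K2 : ∀ a b c e, G.Adj a b → G.Adj c e → ¬ G.Adj a c → ¬ G.Adj a e → ¬ G.Adj b c →
      ¬ G.Adj b e → False)
    (noC4 : ∀ a b c e, G.Adj a b → G.Adj b c → G.Adj c e → G.Adj e a → ¬ G.Adj a c →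
      ¬ G.Adj b e → a ≠ c → b ≠ e → False)
    (noC5 : ∀ a b c e f, G.Adj a b → G.Adj b c → G.Adj c e → G.Adj e f → G.Adj f a →
      ¬ G.Adj a c → ¬ G.Adj b e → ¬ G.Adj c f → ¬ G.Adj e a → ¬ G.Adj f b → False) :
    IsSplit G := by
  classical
  have : Fintype V := Fintype.ofFinite V
  obtain ⟨K₀, hK₀, hmax₀⟩ := Finset.exists_max_image
    (Finset.univ.filter fun K : Finset V => G.IsClique (K : Set V)) Finset.card
    ⟨∅, by simp⟩
  -- Among the maximum cliques, `K` has the largest degree sum; this second choice is what bounds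
  -- degrees under exchanges.
  obtain ⟨K, hK, hmax⟩ := Finset.exists_max_image
    (Finset.univ.filter fun K : Finset V => G.IsClique (K : Set V) ∧ K.card = K₀.card)
    (fun K => ∑ v ∈ K, (G.neighborSet v).ncard) ⟨K₀, by simpa using hK₀⟩
  simp only [Finset.mem_filter, Finset.mem_univ, true_and] at hK₀ hmax₀ hK hmax
  obtain ⟨hK, hcard⟩ := hK
  have hadj : ∀ u ∈ K, ∀ v ∈ K, u ≠ v → G.Adj u v := fun u hu v hv h => hK hu hv h
  have outside : ∀ {x u : V}, x ∉ K → u ∈ K → x ≠ u := fun hx hu h => hx (h ▸ hu)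
  have miss : ∀ x ∉ K, ∃ u ∈ K, ¬ G.Adj x u := by
    intro x hx
    by_contra! h
    have hc : G.IsClique (insert x K : Finset V) := by
      rw [Finset.coe_insert]
      exact hK.insert fun b hb _ => h b hb
    have := hmax₀ _ hc
    rw [Finset.card_insert_of_notMem hx] at this
    omega
  have exch : ∀ x ∉ K, ∀ v ∈ K, (∀ u ∈ K, u ≠ v → G.Adj x u) →
      G.IsClique (insert x (K.erase v) : Finset V) ∧
        (insert x (K.erase v)).card = K₀.card := by
    intro x hx v hv h
    constructor
    · rw [Finset.coe_insert, Finset.coe_erase]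
      refine SimpleGraph.IsClique.insert (hK.subset Set.sdiff_subset) fun b hb _ => h b hb.1 hb.2
    · rw [Finset.card_insert_of_notMem (by simp [hx]), Finset.card_erase_of_mem hv, ← hcard]
      have := Finset.card_pos.2 ⟨v, hv⟩
      omega
  have main : ∀ x ∉ K, ∀ y ∉ K, G.Adj x y → ∀ u ∈ K, ∀ v ∈ K, u ≠ v → ¬ G.Adj x u →
      ¬ G.Adj x v → G.Adj y u → ¬ G.Adj y v → False := by
    intro x hx y hy hxy u hu v hv huv hxu hxv hyu hyv
    have hall : ∀ w ∈ K, w ≠ v → G.Adj y w := by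
      intro w hw hwv
      by_contra hyw
      have hwu : w ≠ u := by rintro rfl; exact hyw hyu
      by_cases hxw : G.Adj x w
      · exact noC4 x y u w hxy hyu (hadj u hu w hw hwu.symm) hxw.symm hxu hyw (outside hx hu)
          (outside hy hw)
      · exact no2K2 x y v w hxy (hadj v hv w hw hwv.symm) hxv hxw hyv hyw
    -- Replacing `v` by `y` gives another maximum clique, so `y` has degree at most that of `v`. As
    -- `x` sees `y` but not `v`, some `z` sees `v` but not `y`, and `z` completes a forbidden
    -- subgraph.
    obtain ⟨hc, hcc⟩ := exch y hy v hv hall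
    have hle := hmax _ ⟨hc, hcc⟩
    rw [Finset.sum_insert (by simp [hy]), ← Finset.add_sum_erase K _ hv] at hle
    have hle : (G.neighborSet y).ncard ≤ (G.neighborSet v).ncard := by omega
    have : ∃ z, G.Adj v z ∧ ¬ G.Adj y z := by
      by_contra! h
      have := Set.ncard_lt_ncard (s := G.neighborSet v) (t := G.neighborSet y)
        ((Set.ssubset_iff_of_subset (fun z hz => h z hz)).2 ⟨x, hxy.symm, fun h => hxv (G.adj_symm h)⟩)
      omega
    obtain ⟨z, hvz, hyz⟩ := this
    have hyz' : y ≠ z := by rintro rfl; exact hyv hvz.symm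
    have hxz : G.Adj x z := by
      by_contra hxz
      exact no2K2 x y v z hxy hvz hxv hxz hyv hyz
    have hvu := hadj v hv u hu huv.symm
    have hzy : ¬ G.Adj z y := fun h => hyz h.symm
    have hux : ¬ G.Adj u x := fun h => hxu h.symm
    by_cases hzu : G.Adj z u
    · exact noC4 z u y x hzu hyu.symm hxy.symm hxz hzy hux hyz'.symm (outside hx hu).symm
    · exact noC5 z v u y x hvz.symm hvu hyu.symm hxy.symm hxz hzu (fun h => hyv h.symm) hux hyz hxv
  have final : ∀ p ∉ K, ∀ q ∉ K, G.Adj p q → ∀ u ∈ K, ∀ v ∈ K, u ≠ v → ¬ G.Adj p u →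
      ¬ G.Adj q v → False := by
    intro p hp q hq hpq u hu v hv huv hpu hqv
    by_cases hpv : G.Adj p v <;> by_cases hqu : G.Adj q u
    · exact noC4 p q u v hpq hqu (hadj u hu v hv huv) hpv.symm hpu hqv (outside hp hu)
        (outside hq hv)
    · exact main q hq p hp hpq.symm v hv u hu huv.symm hqv hqu hpv hpu
    · exact main p hp q hq hpq u hu v hv huv hpu hpv hqu hqv
    · exact no2K2 p q u v hpq (hadj u hu v hv huv) hpu hpv hqu hqv
  refine ⟨K, hK, ?_⟩
  intro p hp q hq hpq' hpq
  have hp : p ∉ K := hp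
  have hq : q ∉ K := hq
  obtain ⟨u, hu, hpu⟩ := miss p hp
  obtain ⟨v, hv, hqv⟩ := miss q hq
  by_cases huv : u = v
  · subst huv
    by_cases h : ∃ w ∈ K, w ≠ u ∧ ¬ G.Adj p w
    · obtain ⟨w, hw, hwu, hpw⟩ := h
      exact final p hp q hq hpq w hw u hu hwu hpw hqv
    by_cases h' : ∃ w ∈ K, w ≠ u ∧ ¬ G.Adj q w
    · obtain ⟨w, hw, hwu, hqw⟩ := h'
      exact final p hp q hq hpq u hu w hw hwu.symm hpu hqw
    -- Now `p` and `q` both miss only `u` in `K`, so trading `u` for the two of them gives a larger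
    -- clique.
    push Not at h h'
    obtain ⟨hc, hcc⟩ := exch p hp u hu h
    have hc' : G.IsClique (insert q (insert p (K.erase u)) : Finset V) := by
      rw [Finset.coe_insert]
      refine hc.insert fun b hb _ => ?_
      rcases Finset.mem_insert.1 hb with rfl | hb
      · exact hpq.symm
      · exact h' b (Finset.mem_of_mem_erase hb) (Finset.ne_of_mem_erase hb)
    have := hmax₀ _ hc'
    rw [Finset.card_insert_of_notMem (by simp [hq, hpq'.symm]), hcc] at this
    omega
  · exact final p hp q hq hpq u hu v hv huv hpu hqv

/-- `w x y z` is an induced path. -/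
structure IsInducedPath (G : SimpleGraph V) (w x y z : V) : Prop where
  wx : G.Adj w x
  xy : G.Adj x y
  yz : G.Adj y z
  wy : ¬ G.Adj w y
  wz : ¬ G.Adj w z
  xz : ¬ G.Adj x z

theorem IsInducedPath.reverse {w x y z : V} (h : IsInducedPath G w x y z) :
    IsInducedPath G z y x w :=
  ⟨h.yz.symm, h.xy.symm, h.wx.symm, fun e => h.xz e.symm, fun e => h.wz e.symm,
    fun e => h.wy e.symm⟩

theorem IsInducedPath.nodup {w x y z : V} (h : IsInducedPath G w x y z) :
    w ≠ x ∧ w ≠ y ∧ w ≠ z ∧ x ≠ y ∧ x ≠ z ∧ y ≠ z := by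
  have := h.wx.ne
  have := h.xy.ne
  have := h.yz.ne
  obtain ⟨h1, h2, h3, h4, h5, h6⟩ := h
  have := h1.symm
  have := h2.symm
  have := h3.symm
  refine ⟨by assumption, ?_, ?_, by assumption, ?_, by assumption⟩
  · rintro rfl; contradiction
  · rintro rfl; contradiction
  · rintro rfl; contradiction

theorem IsInducedPath.isAlternating {w x y z : V} (h : IsInducedPath G w x y z) :
    IsAlternating G x w y z :=
  ⟨h.wx.symm, h.yz, h.xz, h.wy, h.nodup.2.2.2.1, h.nodup.2.2.1, h.nodup.2.2.2.2.1, h.nodup.2.1⟩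

theorem inducesP4_iff {S : Set V} :
    InducesP4 G S ↔ ∃ w x y z, IsInducedPath G w x y z ∧ S = {w, x, y, z} := by
  constructor
  · rintro ⟨φ⟩
    have e : ∀ i j : Fin 4, G.Adj (φ.symm i) (φ.symm j) ↔ (SimpleGraph.pathGraph 4).Adj i j :=
      fun i j => φ.symm.map_adj_iff
    refine ⟨φ.symm 0, φ.symm 1, φ.symm 2, φ.symm 3,
      ⟨?_, ?_, ?_, ?_, ?_, ?_⟩, ?_⟩
    · rw [e, SimpleGraph.pathGraph_adj]; decide
    · rw [e, SimpleGraph.pathGraph_adj]; decide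
    · rw [e, SimpleGraph.pathGraph_adj]; decide
    · rw [e, SimpleGraph.pathGraph_adj]; decide
    · rw [e, SimpleGraph.pathGraph_adj]; decide
    · rw [e, SimpleGraph.pathGraph_adj]; decide
    · ext v
      constructor
      · intro hv
        obtain ⟨i, hi⟩ := φ.symm.surjective ⟨v, hv⟩
        have hi : (φ.symm i : V) = v := congrArg Subtype.val hi
        fin_cases i <;> simp_all
      · rintro (rfl | rfl | rfl | rfl) <;> exact Subtype.coe_prop _
  · rintro ⟨w, x, y, z, h, rfl⟩
    obtain ⟨n1, n2, n3, n4, n5, n6⟩ := h.nodup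
    let f : Fin 4 → ({w, x, y, z} : Set V) :=
      ![⟨w, by simp⟩, ⟨x, by simp⟩, ⟨y, by simp⟩, ⟨z, by simp⟩]
    have hf : Function.Bijective f := by
      constructor
      · intro i j hij
        fin_cases i <;> fin_cases j <;> simp_all [f]
      · rintro ⟨v, rfl | rfl | rfl | rfl⟩
        · exact ⟨0, rfl⟩
        · exact ⟨1, rfl⟩
        · exact ⟨2, rfl⟩
        · exact ⟨3, rfl⟩
    refine ⟨SimpleGraph.Iso.symm ⟨Equiv.ofBijective f hf, ?_⟩⟩
    intro i j
    obtain ⟨h1, h2, h3, h4, h5, h6⟩ := h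
    rw [SimpleGraph.pathGraph_adj]
    fin_cases i <;> fin_cases j <;> simp [f, h1, h2, h3, h4, h5, h6, G.adj_comm z, G.adj_comm y _,
      G.adj_comm x w]

end Split

/-! ### From twin and incomparability conditions to `P₄`-reducibility. -/

section Split

variable {V : Type*} {G : SimpleGraph V}

theorem IsAlternating.mem_clique {K : Set V} (hK : G.IsClique K) (hI : G.IsIndepSet Kᶜ)
    {a b c e : V} (h : IsAlternating G a b c e) :
    (a ∈ K ∧ c ∈ K ∧ b ∉ K ∧ e ∉ K) ∨ (a ∉ K ∧ c ∉ K ∧ b ∈ K ∧ e ∈ K) := by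
  have ab : a ∉ K → b ∈ K := fun h1 => by_contra fun h2 => hI h1 h2 h.ab.ne h.ab
  have ce : c ∉ K → e ∈ K := fun h1 => by_contra fun h2 => hI h1 h2 h.cd.ne h.cd
  have ae : a ∈ K → e ∉ K := fun h1 h2 => h.ad (hK h1 h2 h.ad_ne)
  have bc : b ∈ K → c ∉ K := fun h1 h2 => h.bc (hK h1 h2 h.bc_ne)
  tauto

theorem IsInducedPath.mem_clique {K : Set V} (hK : G.IsClique K) (hI : G.IsIndepSet Kᶜ)
    {w x y z : V} (h : IsInducedPath G w x y z) : x ∈ K ∧ y ∈ K ∧ w ∉ K ∧ z ∉ K := by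
  rcases h.isAlternating.mem_clique hK hI with h' | h'
  · exact h'
  · exact absurd (hK h'.2.2.1 h'.2.2.2 h.nodup.2.2.1) h.wz

/-- In a split graph, an alternating closed walk based in the clique comes from an induced path. -/
theorem IsAlternating.isInducedPath {K : Set V} (hK : G.IsClique K) (hI : G.IsIndepSet Kᶜ)
    {a b c e : V} (h : IsAlternating G a b c e) (ha : a ∈ K) : IsInducedPath G b a c e := by
  rcases h.mem_clique hK hI with ⟨_, hc, hb, he⟩ | h'
  · exact ⟨h.ab.symm, hK ha hc h.ac_ne, h.cd, h.bc, hI hb he h.bd_ne, h.ad⟩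
  · exact absurd ha h'.1

theorem InducesP4.exists_isAlternating {S : Set V} (hS : InducesP4 G S) {v : V} (hv : v ∈ S) :
    ∃ p b e, IsAlternating G v b p e ∧ S = {v, p, b, e} := by
  obtain ⟨w, x, y, z, h, rfl⟩ := inducesP4_iff.1 hS
  have ha := h.isAlternating
  rcases hv with rfl | rfl | rfl | rfl
  · exact ⟨z, x, y, ha.reverse, by grind⟩
  · exact ⟨y, w, z, ha, by grind⟩
  · exact ⟨x, z, w, ha.opposite, by grind⟩
  · exact ⟨w, y, x, ha.opposite.reverse, by grind⟩

/-- Write two induced paths through `v` as alternating walks in which `v` is opposite `p`,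
respectively `p'`. If `p = p'`, then `huni` identifies the walks. Otherwise `huni` either gives a
contradiction or makes `p`, `v`, `p'` pairwise incomparable. -/
theorem isP4Reducible_of_isSplit (hG : IsSplit G)
    (huni : ∀ a b c e u, IsAlternating G a b c e → u ≠ a → u ≠ b → u ≠ c → u ≠ e →
      (G.Adj u a ↔ G.Adj u c))
    (hinc : ∀ x y v, Incomparable G x y → Incomparable G y v → ¬ Incomparable G x v) :
    IsP4Reducible G := by
  obtain ⟨K, hK, hI⟩ := hG
  intro v S T hvS hvT hS hT
  obtain ⟨p, b, e, h, rfl⟩ := hS.exists_isAlternating hvS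
  obtain ⟨p', b', e', h', rfl⟩ := hT.exists_isAlternating hvT
  have hm := h.mem_clique hK hI
  have hm' := h'.mem_clique hK hI
  have m1 : p ∈ K ↔ v ∈ K := by grind
  have m2 : b ∈ K ↔ v ∉ K := by grind
  have m3 : e ∈ K ↔ v ∉ K := by grind
  have m4 : p' ∈ K ↔ v ∈ K := by grind
  have m5 : b' ∈ K ↔ v ∉ K := by grind
  have m6 : e' ∈ K ↔ v ∉ K := by grind
  clear hm hm'
  -- `v`, `p`, `p'` lie on one side of the split partition and `b`, `e`, `b'`, `e'` on the other,
  -- which supplies most of the distinctness needed.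
  have sep : ∀ {x y : V}, (x ∈ K ↔ v ∈ K) → (y ∈ K ↔ v ∉ K) → x ≠ y := by
    rintro x y h1 h2 rfl
    exact iff_not_self (h1.symm.trans h2)
  by_cases hpp : p = p'
  · subst hpp
    have hb : b' = b := by
      by_contra hb
      have := huni _ _ _ _ b' h h'.ab.ne' hb h'.bc_ne (by rintro rfl; exact h.ad h'.ab)
      exact h'.bc (this.1 h'.ab.symm)
    have he : e' = e := by
      by_contra he
      have := huni _ _ _ _ e' h h'.ad_ne.symm (by rintro rfl; exact h'.ad h.ab) h'.cd.ne' he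
      exact h'.ad (this.2 h'.cd.symm).symm
    rw [hb, he]
  exfalso
  have f1 := huni _ _ _ _ p' h.reverse (sep m4 m2) h'.ac_ne.symm (sep m4 m3)
    (Ne.symm hpp)
  have f2 := huni _ _ _ _ p h'.reverse (sep m1 m5) h.ac_ne.symm (sep m1 m6) hpp
  have f3 : b' ≠ b → G.Adj p b' := fun hb =>
    ((huni _ _ _ _ b' h h'.ab.ne' hb (sep m1 m5).symm
      (by rintro rfl; exact h.ad h'.ab)).1 h'.ab.symm).symm
  have f4 : e' ≠ e → ¬ G.Adj p e' := fun he hpe =>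
    h'.ad ((huni _ _ _ _ e' h h'.ad_ne.symm (by rintro rfl; exact h'.ad h.ab) (sep m1 m6).symm
      he).2 hpe.symm).symm
  by_cases hb : b' = b <;> by_cases he : e' = e
  · subst hb he
    exact h'.bc (f1.2 h'.cd).symm
  · subst hb
    refine hinc p v p' h.incomparable.symm h'.incomparable
      ⟨e, e', h.cd, h'.cd, f4 he, fun hh => h'.bc (f1.2 hh.symm).symm, hpp, Ne.symm he, ?_, ?_⟩
    · exact sep m1 m6
    · exact (sep m4 m3).symm
  · subst he
    refine hinc p v p' h.incomparable.symm h'.incomparable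
      ⟨b', b, f3 hb, f1.2 h'.cd, fun hh => h.bc hh.symm, h'.bc, hpp, hb, ?_, ?_⟩
    · exact sep m1 m2
    · exact (sep m4 m5).symm
  · exact f4 he (f2.1 (f3 hb))

end Split

theorem IsHypercube.isSplit_and_isP4Reducible {n : ℕ} {d : Fin n → ℕ} {G : SimpleGraph (Fin n)}
    (hd : IsHypercube (realizationGraph d)) (hG : IsRealization d G) :
    IsSplit G ∧ IsP4Reducible G := by
  have hs : IsSplit G := by
    refine isSplit_of_forbidden ?_ ?_ ?_
    · intro a b c e hab hce hac hae hbc hbe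
      refine hd.diagonal hG (a := a) (b := b) (c := c) (e := e)
        ⟨hab, hce, hae, hbc, ?_, ?_, ?_, ?_⟩ (by tauto)
      · rintro rfl; exact hae hce
      · rintro rfl; exact hae hab
      · rintro rfl; exact hac hce.symm
      · rintro rfl; exact hac hab
    · intro a b c e hab hbc hce hea hac hbe nac nbe
      exact hd.diagonal hG (a := a) (b := b) (c := e) (e := c)
        ⟨hab, hce.symm, hac, hbe, hea.ne', hbc.ne, nac, nbe⟩ (by
          have := hea.symm; tauto)
    · intro a b c e f hab hbc hce hef hfa hac hbe hcf hea hfb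
      have nbe : b ≠ e := by rintro rfl; exact hea hab.symm
      have nac : a ≠ c := by rintro rfl; exact hcf hfa.symm
      have nfb : f ≠ b := by rintro rfl; exact hcf hbc.symm
      have nea : e ≠ a := by rintro rfl; exact hac hce.symm
      have ncf : c ≠ f := by rintro rfl; exact hac hfa.symm
      -- Three consecutive vertices of an induced `C₅` are pairwise incomparable.
      refine hd.not_incomparable hG (x := a) (y := b) (v := c)
        ⟨f, c, hfa.symm, hbc, hac, hfb, hab.ne, ncf.symm, nac, nfb⟩
        ⟨a, e, hab.symm, hce, hbe, hac, hbc.ne, nea.symm, nbe, nac⟩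
        ⟨f, e, hfa.symm, hce, fun h => hea h.symm, fun h => hcf h.symm, nac, hef.ne', nea.symm,
          ncf.symm⟩
  refine ⟨hs, isP4Reducible_of_isSplit hs ?_ ?_⟩
  · intro a b c e u h
    exact hd.adj_iff_of_alternating hG h
  · intro x y v hxy hyv
    exact hd.not_incomparable hG hxy hyv

/-! ### Split `P₄`-reducible graphs: independent exchanges of midpoints. -/

section Reducible

variable {V W : Type*} {G : SimpleGraph V}

theorem IsInducedPath.comap_iff {e : W ≃ V} {w x y z : W} :
    IsInducedPath (G.comap e) w x y z ↔ IsInducedPath G (e w) (e x) (e y) (e z) :=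
  ⟨fun ⟨h1, h2, h3, h4, h5, h6⟩ => ⟨h1, h2, h3, h4, h5, h6⟩,
    fun ⟨h1, h2, h3, h4, h5, h6⟩ => ⟨h1, h2, h3, h4, h5, h6⟩⟩

theorem IsSplit.comap (hG : IsSplit G) (e : W ≃ V) : IsSplit (G.comap e) := by
  obtain ⟨K, hK, hI⟩ := hG
  exact ⟨e ⁻¹' K, fun u hu v hv h => hK hu hv (e.injective.ne h),
    fun u hu v hv h => hI hu hv (e.injective.ne h)⟩

theorem InducesP4.image {e : W ≃ V} {S : Set W} (h : InducesP4 (G.comap e) S) :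
    InducesP4 G (e '' S) := by
  obtain ⟨w, x, y, z, hp, rfl⟩ := inducesP4_iff.1 h
  exact inducesP4_iff.2 ⟨_, _, _, _, IsInducedPath.comap_iff.1 hp, by simp [Set.image_insert_eq]⟩

theorem IsP4Reducible.comap (hG : IsP4Reducible G) (e : W ≃ V) : IsP4Reducible (G.comap e) :=
  fun v _ _ hvS hvT hS hT => e.injective.image_injective
    (hG (e v) _ _ (Set.mem_image_of_mem _ hvS) (Set.mem_image_of_mem _ hvT) hS.image hT.image)

/-- A vertex `v` seeing only `x` of the two midpoints would lie in the independent part, so `v x y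
z` would be a second induced path through `x`. -/
theorem IsInducedPath.adj_mid (hs : IsSplit G) (hr : IsP4Reducible G) {w x y z v : V}
    (h : IsInducedPath G w x y z) (hvw : v ≠ w) (hvx : v ≠ x) (hvy : v ≠ y) (hvz : v ≠ z)
    (hv : G.Adj v x) : G.Adj v y := by
  obtain ⟨K, hK, hI⟩ := hs
  obtain ⟨hx, hy, hw, hz⟩ := h.mem_clique hK hI
  by_contra hvy'
  have hvK : v ∉ K := fun hvK => hvy' (hK hvK hy hvy)
  have h' : IsInducedPath G v x y z := ⟨hv, h.xy, h.yz, hvy', hI hvK hz hvz, h.xz⟩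
  have := hr x {w, x, y, z} {v, x, y, z} (by simp) (by simp) (inducesP4_iff.2 ⟨_, _, _, _, h, rfl⟩)
    (inducesP4_iff.2 ⟨_, _, _, _, h', rfl⟩)
  have hv' : v ∈ ({v, x, y, z} : Set V) := by simp
  rw [← this] at hv'
  simp [hvw, hvx, hvy, hvz] at hv'

/-- In a split `P₄`-reducible graph, a 2-switch exchanges the midpoints of an induced path. -/
theorem IsInducedPath.twoSwitch_eq [DecidableEq V] (hs : IsSplit G) (hr : IsP4Reducible G)
    {w x y z : V} (h : IsInducedPath G w x y z) :
    twoSwitch G x w y z = G.comap (Equiv.swap x y) :=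
  h.isAlternating.twoSwitch_eq_comap_swap fun _ h1 h2 h3 h4 =>
    ⟨h.adj_mid hs hr h2 h1 h3 h4, h.reverse.adj_mid hs hr h4 h3 h1 h2⟩

theorem isTwoSwitch_iff_swap [DecidableEq V] (hs : IsSplit G) (hr : IsP4Reducible G)
    {H : SimpleGraph V} : IsTwoSwitch G H ↔
      ∃ w x y z, IsInducedPath G w x y z ∧ H = G.comap (Equiv.swap x y) := by
  constructor
  · intro h
    obtain ⟨a, b, c, e, ha, rfl⟩ := isTwoSwitch_iff.1 h
    obtain ⟨K, hK, hI⟩ := id hs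
    rcases ha.mem_clique hK hI with ⟨haK, -⟩ | ⟨-, -, hbK, -⟩
    · have hp := ha.isInducedPath hK hI haK
      exact ⟨_, _, _, _, hp, hp.twoSwitch_eq hs hr⟩
    · have hp := ha.reverse.isInducedPath hK hI hbK
      exact ⟨_, _, _, _, hp, by rw [← hp.twoSwitch_eq hs hr, twoSwitch_reverse]⟩
  · rintro ⟨w, x, y, z, h, rfl⟩
    rw [← h.twoSwitch_eq hs hr]
    exact h.isAlternating.isTwoSwitch

/-- A list of the induced four-vertex paths of `G`, each one given once, with disjoint pairs of
midpoints. -/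
structure PathList (G : SimpleGraph V) (k : ℕ) where
  w : Fin k → V
  x : Fin k → V
  y : Fin k → V
  z : Fin k → V
  path : ∀ i, IsInducedPath G (w i) (x i) (y i) (z i)
  complete : ∀ {a b c e}, IsInducedPath G a b c e →
    ∃ i, (b = x i ∧ c = y i) ∨ (b = y i ∧ c = x i)
  x_inj : ∀ {i j}, x i = x j → i = j
  y_inj : ∀ {i j}, y i = y j → i = j
  x_ne_y : ∀ i j, x i ≠ y j
  w_ne : ∀ i j, w i ≠ x j ∧ w i ≠ y j
  z_ne : ∀ i j, z i ≠ x j ∧ z i ≠ y j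

/-- Enumerate the vertex sets of induced `P₄`s, pairwise disjoint by reducibility. In each, the
midpoints are the two vertices in the clique, so they depend on the set alone. -/
theorem exists_pathList [Finite V] (hs : IsSplit G) (hr : IsP4Reducible G) :
    ∃ k, Nonempty (PathList G k) := by
  obtain ⟨K, hK, hI⟩ := hs
  obtain ⟨k, ⟨φ⟩⟩ := Finite.exists_equiv_fin {S : Set V // InducesP4 G S}
  have hφ : ∀ i, ∃ w x y z, IsInducedPath G w x y z ∧ ((φ.symm i : Set V)) = {w, x, y, z} :=
    fun i => inducesP4_iff.1 (φ.symm i).2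
  choose w x y z hp hS using hφ
  have inj : ∀ {i j v}, v ∈ ({w i, x i, y i, z i} : Set V) →
      v ∈ ({w j, x j, y j, z j} : Set V) → i = j := by
    intro i j v hi hj
    rw [← hS] at hi hj
    exact φ.symm.injective (Subtype.ext (hr v _ _ hi hj (φ.symm i).2 (φ.symm j).2))
  have mem := fun i => (hp i).mem_clique hK hI
  refine ⟨k, ⟨⟨w, x, y, z, hp, ?_, ?_, ?_, ?_, ?_, ?_⟩⟩⟩
  · intro a b c e h
    obtain ⟨hb, hc, ha, he⟩ := h.mem_clique hK hI
    let S : {S : Set V // InducesP4 G S} := ⟨{a, b, c, e}, inducesP4_iff.2 ⟨_, _, _, _, h, rfl⟩⟩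
    have e1 := hS (φ S)
    rw [Equiv.symm_apply_apply] at e1
    have e1 : ({a, b, c, e} : Set V) = _ := e1
    obtain ⟨m1, m2, m3, m4⟩ := mem (φ S)
    have hb' : b ∈ ({a, b, c, e} : Set V) := by simp
    have hc' : c ∈ ({a, b, c, e} : Set V) := by simp
    rw [e1] at hb' hc'
    have hbc := h.xy.ne
    simp only [Set.mem_insert_iff, Set.mem_singleton_iff] at hb' hc'
    exact ⟨φ S, by grind⟩
  · intro i j h
    exact inj (v := x i) (by simp) (by simp [h])
  · intro i j h
    exact inj (v := y i) (by simp) (by simp [h])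
  · intro i j h
    have : i = j := inj (v := x i) (by simp) (by simp [h])
    subst this
    exact (hp i).xy.ne h
  · exact fun i j => ⟨fun h => (mem i).2.2.1 (h ▸ (mem j).1),
      fun h => (mem i).2.2.1 (h ▸ (mem j).2.1)⟩
  · exact fun i j => ⟨fun h => (mem i).2.2.2 (h ▸ (mem j).1),
      fun h => (mem i).2.2.2 (h ▸ (mem j).2.1)⟩

namespace PathList

variable {k : ℕ} (P : PathList G k)

open scoped Classical in
/-- Exchange the midpoints of the paths selected by `f`. -/
noncomputable def flipFun (f : Fin k → Bool) (v : V) : V :=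
  if h : ∃ i, v = P.x i ∧ f i = true then P.y h.choose
  else if h : ∃ i, v = P.y i ∧ f i = true then P.x h.choose
  else v

theorem flipFun_x (f : Fin k → Bool) (i : Fin k) :
    P.flipFun f (P.x i) = if f i then P.y i else P.x i := by
  unfold flipFun
  have h2 : ¬ ∃ j, P.x i = P.y j ∧ f j = true := fun ⟨j, h, _⟩ => P.x_ne_y i j h
  split_ifs with h1 h h
  · rw [← P.x_inj h1.choose_spec.1]
  · rw [P.x_inj h1.choose_spec.1] at h
    exact absurd h1.choose_spec.2 h
  · exact absurd ⟨i, rfl, h⟩ h1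
  · rfl

theorem flipFun_y (f : Fin k → Bool) (i : Fin k) :
    P.flipFun f (P.y i) = if f i then P.x i else P.y i := by
  unfold flipFun
  have h2 : ¬ ∃ j, P.y i = P.x j ∧ f j = true := fun ⟨j, h, _⟩ => P.x_ne_y j i h.symm
  rw [dif_neg h2]
  split_ifs with h1 h h
  · rw [← P.y_inj h1.choose_spec.1]
  · rw [P.y_inj h1.choose_spec.1] at h
    exact absurd h1.choose_spec.2 h
  · exact absurd ⟨i, rfl, h⟩ h1
  · rfl

theorem flipFun_of_ne (f : Fin k → Bool) {v : V} (h : ∀ i, v ≠ P.x i ∧ v ≠ P.y i) :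
    P.flipFun f v = v := by
  unfold flipFun
  rw [dif_neg fun ⟨i, hi, _⟩ => (h i).1 hi, dif_neg fun ⟨i, hi, _⟩ => (h i).2 hi]

theorem cases_vertex (v : V) :
    (∃ i, v = P.x i) ∨ (∃ i, v = P.y i) ∨ ∀ i, v ≠ P.x i ∧ v ≠ P.y i := by
  by_cases h1 : ∃ i, v = P.x i
  · exact .inl h1
  by_cases h2 : ∃ i, v = P.y i
  · exact .inr (.inl h2)
  push Not at h1 h2
  exact .inr (.inr fun i => ⟨h1 i, h2 i⟩)

theorem flipFun_involutive (f : Fin k → Bool) : Function.Involutive (P.flipFun f) := by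
  intro v
  rcases P.cases_vertex v with ⟨i, rfl⟩ | ⟨i, rfl⟩ | h
  · cases h : f i <;> simp [flipFun_x, flipFun_y, h]
  · cases h : f i <;> simp [flipFun_x, flipFun_y, h]
  · rw [P.flipFun_of_ne f h, P.flipFun_of_ne f h]

/-- `flipFun` as a permutation. -/
noncomputable def flipPerm (f : Fin k → Bool) : Equiv.Perm V := (P.flipFun_involutive f).toPerm

theorem flipPerm_x (f : Fin k → Bool) (i : Fin k) :
    P.flipPerm f (P.x i) = if f i then P.y i else P.x i := P.flipFun_x f i

theorem flipPerm_y (f : Fin k → Bool) (i : Fin k) :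
    P.flipPerm f (P.y i) = if f i then P.x i else P.y i := P.flipFun_y f i

theorem flipPerm_of_ne (f : Fin k → Bool) {v : V} (h : ∀ i, v ≠ P.x i ∧ v ≠ P.y i) :
    P.flipPerm f v = v := P.flipFun_of_ne f h

theorem flipPerm_update [DecidableEq V] (f : Fin k → Bool) (i : Fin k) :
    P.flipPerm (Function.update f i (!f i)) = P.flipPerm f * Equiv.swap (P.x i) (P.y i) := by
  ext v : 1
  rw [Equiv.Perm.mul_apply]
  rcases P.cases_vertex v with ⟨j, rfl⟩ | ⟨j, rfl⟩ | h
  · by_cases hj : j = i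
    · subst hj
      cases hf : f j <;> simp [flipPerm_x, flipPerm_y, hf]
    · rw [Equiv.swap_apply_of_ne_of_ne (fun h => hj (P.x_inj h)) (P.x_ne_y j i), flipPerm_x,
        flipPerm_x, Function.update_of_ne hj]
  · by_cases hj : j = i
    · subst hj
      cases hf : f j <;> simp [flipPerm_x, flipPerm_y, hf]
    · rw [Equiv.swap_apply_of_ne_of_ne (P.x_ne_y i j).symm (fun h => hj (P.y_inj h)), flipPerm_y,
        flipPerm_y, Function.update_of_ne hj]
  · rw [Equiv.swap_apply_of_ne_of_ne (h i).1 (h i).2, P.flipPerm_of_ne _ h, P.flipPerm_of_ne _ h]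

/-- The graph in which the midpoints of the paths selected by `f` are exchanged. -/
noncomputable def flip (f : Fin k → Bool) : SimpleGraph V := G.comap (P.flipPerm f)

theorem flip_update [DecidableEq V] (f : Fin k → Bool) (i : Fin k) :
    P.flip (Function.update f i (!f i)) = (P.flip f).comap (Equiv.swap (P.x i) (P.y i)) := by
  rw [flip, flipPerm_update]
  rfl

theorem flip_false : P.flip (fun _ => false) = G := by
  have : P.flipPerm (fun _ => false) = 1 := by
    ext v : 1
    rcases P.cases_vertex v with ⟨j, rfl⟩ | ⟨j, rfl⟩ | h
    · simp [flipPerm_x]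
    · simp [flipPerm_y]
    · simp [P.flipPerm_of_ne _ h]
  rw [flip, this]
  rfl

/-- The endpoint `w i` is never moved, so this one adjacency reads off `f i`; injectivity of `flip`
follows. -/
theorem flip_adj_iff (f : Fin k → Bool) (i : Fin k) :
    (P.flip f).Adj (P.w i) (P.x i) ↔ f i = false := by
  rw [flip, SimpleGraph.comap_adj, P.flipPerm_of_ne f (P.w_ne i), flipPerm_x]
  cases f i <;> simp [(P.path i).wx, (P.path i).wy]

theorem flip_injective : Function.Injective P.flip := by
  intro f g h
  funext i
  have h1 := P.flip_adj_iff f i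
  rw [h, P.flip_adj_iff g i] at h1
  cases hf : f i <;> cases hg : g i <;> simp_all

/-- `P.flip f` is an isomorphic copy of `G`, hence again split and `P₄`-reducible, and the
permutation preserves each pair `x i`, `y i`. So its 2-switches exchange the same midpoint pairs as
those of `G`. -/
theorem isTwoSwitch_flip_iff (hs : IsSplit G) (hr : IsP4Reducible G) (f : Fin k → Bool)
    {H : SimpleGraph V} :
    IsTwoSwitch (P.flip f) H ↔ ∃ i, H = P.flip (Function.update f i (!f i)) := by
  classical
  simp only [flip_update]
  rw [isTwoSwitch_iff_swap (G := P.flip f) (hs.comap _) (hr.comap _)]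
  constructor
  · rintro ⟨w, x, y, z, h, rfl⟩
    obtain ⟨i, hi⟩ := P.complete (IsInducedPath.comap_iff.1 h)
    have hx := P.flipPerm_x f i
    have hy := P.flipPerm_y f i
    have inj : ∀ {u v}, P.flipPerm f u = P.flipPerm f v → u = v :=
      fun h => (P.flipPerm f).injective h
    refine ⟨i, ?_⟩
    have hxy : (x = P.x i ∧ y = P.y i) ∨ (x = P.y i ∧ y = P.x i) := by
      cases hf : f i <;> simp only [hf, if_true, if_false, Bool.false_eq_true] at hx hy <;>
        rcases hi with ⟨h1, h2⟩ | ⟨h1, h2⟩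
      · exact .inl ⟨inj (h1.trans hx.symm), inj (h2.trans hy.symm)⟩
      · exact .inr ⟨inj (h1.trans hy.symm), inj (h2.trans hx.symm)⟩
      · exact .inr ⟨inj (h1.trans hy.symm), inj (h2.trans hx.symm)⟩
      · exact .inl ⟨inj (h1.trans hx.symm), inj (h2.trans hy.symm)⟩
    rcases hxy with ⟨rfl, rfl⟩ | ⟨rfl, rfl⟩
    · rfl
    · rw [Equiv.swap_comm]
  · rintro ⟨i, rfl⟩
    have hw := P.flipPerm_of_ne f (P.w_ne i)
    have hz := P.flipPerm_of_ne f (P.z_ne i)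
    cases hf : f i
    · refine ⟨P.w i, P.x i, P.y i, P.z i, ?_, rfl⟩
      rw [flip, IsInducedPath.comap_iff, hw, hz, flipPerm_x, flipPerm_y, hf]
      exact P.path i
    -- Once the midpoints are exchanged, `x i` is next to `z i`, so the path runs with its ends
    -- reversed.
    · refine ⟨P.z i, P.x i, P.y i, P.w i, ?_, rfl⟩
      rw [flip, IsInducedPath.comap_iff, hw, hz, flipPerm_x, flipPerm_y, hf]
      exact (P.path i).reverse

theorem reflTransGen_flip (hs : IsSplit G) (hr : IsP4Reducible G) (f : Fin k → Bool) :
    Relation.ReflTransGen IsTwoSwitch G (P.flip f) := by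
  induction hm : (Finset.univ.filter fun i => f i = true).card generalizing f with
  | zero =>
    have : f = fun _ => false := by
      funext i
      simpa using (Finset.filter_eq_empty_iff.1 (Finset.card_eq_zero.1 hm)) (Finset.mem_univ i)
    rw [this, flip_false]
  | succ m ih =>
    obtain ⟨i, hi⟩ := Finset.card_pos.1 (by omega :
      0 < (Finset.univ.filter fun i => f i = true).card)
    have hi' : f i = true := by simpa using hi
    have h1 := ih (Function.update f i (!f i)) (by
      have : (Finset.univ.filter fun j => Function.update f i (!f i) j = true) =
          (Finset.univ.filter fun j => f j = true).erase i := by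
        ext j
        by_cases hj : j = i
        · subst hj; simp [hi']
        · simp [hj]
      rw [this, Finset.card_erase_of_mem hi, hm, Nat.add_sub_cancel])
    exact h1.tail ((P.isTwoSwitch_flip_iff hs hr f).2 ⟨i, rfl⟩).symm

theorem exists_eq_flip_of_reflTransGen (hs : IsSplit G) (hr : IsP4Reducible G)
    {H : SimpleGraph V} (h : Relation.ReflTransGen IsTwoSwitch G H) : ∃ f, P.flip f = H := by
  induction h with
  | refl => exact ⟨_, P.flip_false⟩
  | tail _ h ih =>
    obtain ⟨f, rfl⟩ := ih
    obtain ⟨i, rfl⟩ := (P.isTwoSwitch_flip_iff hs hr f).1 h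
    exact ⟨_, rfl⟩

end PathList

end Reducible

/-! ### The isomorphism with the hypercube, and the main theorem. -/

theorem isHypercube_realizationGraph {n : ℕ} {d : Fin n → ℕ} {G : SimpleGraph (Fin n)}
    (hG : IsRealization d G) (hs : IsSplit G) (hr : IsP4Reducible G) :
    IsHypercube (realizationGraph d) := by
  obtain ⟨k, ⟨P⟩⟩ := exists_pathList hs hr
  have hdeg := (isRealization_iff d G).1 hG
  let F : (Fin k → Bool) → {G : SimpleGraph (Fin n) // IsRealization d G} := fun f =>
    ⟨P.flip f, (isRealization_iff d _).2 fun i =>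
      (ReflTransGen.ncard_neighborSet (P.reflTransGen_flip hs hr f) i).trans (hdeg i)⟩
  have hF : Function.Bijective F := by
    constructor
    · intro f g h
      exact P.flip_injective (congrArg Subtype.val h)
    · rintro ⟨H, hH⟩
      -- Flips are closed under 2-switches, so connectivity makes them exhaust the realizations.
      obtain ⟨f, hf⟩ := P.exists_eq_flip_of_reflTransGen hs hr (reflTransGen_isTwoSwitch G H
        fun v => (hdeg v).trans ((isRealization_iff d H).1 hH v).symm)
      exact ⟨f, Subtype.ext hf⟩
  refine ⟨k, ⟨SimpleGraph.Iso.symm ⟨Equiv.ofBijective F hF, ?_⟩⟩⟩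
  intro f g
  rw [hypercube_adj_iff_update]
  refine (P.isTwoSwitch_flip_iff hs hr f (H := P.flip g)).trans ?_
  simp only [P.flip_injective.eq_iff]

theorem isRealization_comap {n : ℕ} {d : Fin n → ℕ} {V : Type*} [Fintype V] {G : SimpleGraph V}
    (e : Fin n ≃ V) (h : ∀ i, (G.neighborSet (e i)).ncard = d i) :
    IsRealization d (G.comap e) := by
  rw [isRealization_iff]
  intro i
  rw [← h i, ← Set.ncard_image_of_injective _ e.injective]
  congr 1
  ext v
  simp

theorem IsDegreeSequenceOf.exists_isRealization {n : ℕ} {d : Fin n → ℕ} {V : Type*} [Fintype V]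
    {G : SimpleGraph V} (h : IsDegreeSequenceOf d G) :
    ∃ e : Fin n ≃ V, IsRealization d (G.comap e) := by
  classical
  obtain ⟨-, e, he⟩ := h
  refine ⟨e, isRealization_comap e fun i => ?_⟩
  rw [← he i, ← Nat.card_coe_set_eq, Nat.card_eq_fintype_card,
    SimpleGraph.card_neighborSet_eq_degree]

end RealizationGraph

theorem mainTheorem3 {n : ℕ} (d : Fin n → ℕ)
    (hd : ∃ (V : Type) (_ : Fintype V) (G : SimpleGraph V),
      RealizationGraph.IsDegreeSequenceOf d G) :
    RealizationGraph.IsHypercube (RealizationGraph.realizationGraph d) ↔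
      ∃ (V : Type) (_ : Fintype V) (G : SimpleGraph V),
        RealizationGraph.IsDegreeSequenceOf d G ∧
          RealizationGraph.IsSplit G ∧ RealizationGraph.IsP4Reducible G := by
  constructor
  · intro h
    obtain ⟨V, _, G, hG⟩ := hd
    obtain ⟨e, he⟩ := hG.exists_isRealization
    refine ⟨Fin n, inferInstance, G.comap e, ⟨hG.1, Equiv.refl _, ?_⟩,
      h.isSplit_and_isP4Reducible he⟩
    exact he
  · rintro ⟨V, _, G, hG, hs, hr⟩
    obtain ⟨e, he⟩ := hG.exists_isRealization
    exact RealizationGraph.isHypercube_realizationGraph he (hs.comap e) (hr.comap e)
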